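/- Let $\mathbb{F}_{q^s}$ be a finite field with $q^s$ elements. For a linear code $C\subseteq\mathbb{F}_{q^s}^n$ and $0\le r\le\dim C$, let $d_r(C)$ be the $r$-th generalized Hamming weight, i.e. the minimum of $|\mathrm{Supp}(D)|$ over the $r$-dimensional subspaces $D\subseteq C$, where $\mathrm{Supp}(D)$ is the set of coordinates at which some word of $D$ is nonzero (so $d_0(C)=0$). Let $\mathrm{RM}_d(m)$ be the affine Reed-Muller code, the set of evaluations at all points of $\mathbb{F}_{q^s}^m$ of the polynomials over $\mathbb{F}_{q^s}$ in $m$ variables of total degree at most $d$. For $d\ge 1$ let $\mathrm{PRM}_d(m)$ be the projective Reed-Muller code, the set of evaluations of the homogeneous polynomials of degree $d$ in $m+1$ variables at the representatives of the points of $\mathbb{P}^m(\mathbb{F}_{q^s})$ whose first nonzero coordinate is $1$; put $\mathrm{PRM}_d(m)=\{0\}$ for $d\le 0$. **Theorem.** Let $1\le d\le 2(q^s-1)$ and $2\le r\le\dim\mathrm{PRM}_d(2)$. Let $Y$ be the set of pairs of integers $(\alpha,\gamma)$ with $$\max\{r-\dim\mathrm{RM}_{d-1}(2),0\}\le\alpha\le\min\{\dim\mathrm{PRM}_d(1),r\},$$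 $$\max\{r-\dim\mathrm{RM}_d(2),0\}\le\gamma\le\min\{\dim\mathrm{PRM}_{d-(q^s-1)}(1),\alpha\},$$ and for $(\alpha,\gamma)\in Y$ let $$B_{\alpha,\gamma}=\max\{d_{r-\gamma}(\mathrm{RM}_d(2)),d_{r-\alpha}(\mathrm{RM}_{d-1}(2))\}+\max\{d_\alpha(\mathrm{PRM}_d(1)),d_\gamma(\mathrm{PRM}_{d-(q^s-1)}(1))\}.$$ Then $Y\neq\emptyset$ and $$d_r(\mathrm{PRM}_d(2))\ \ge\ \min_{(\alpha,\gamma)\in Y}B_{\alpha,\gamma}.$$ If $r\le\dim\mathrm{RM}_{d-1}(2)$, then $B_{0,0}=d_r(\mathrm{RM}_{d-1}(2))$. For an integer $0\le i\le r$ with $r-i\le\dim\mathrm{RM}_d(2)$, let $\alpha_i$ be the smallest integer with $i\le\alpha_i\le r$ such that $r-\alpha_i\le\dim\mathrm{RM}_{d-1}(2)$ (so that the weight on the left below exists) and $d_{r-\alpha_i}(\mathrm{RM}_{d-1}(2))\le d_{r-i}(\mathrm{RM}_d(2))$, and let $\mu_i=\max\{\alpha_i,\,r-\dim\mathrm{RM}_{d-1}(2)\}$.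 (a) Suppose $d<q^s$, and let $\lambda=\min\{d+1,r\}$. Then $$\min_{(\alpha,\gamma)\in Y}B_{\alpha,\gamma}=\begin{cases}\min\{B_{0,0},H_{\alpha_0,0}\}&\text{if } r\le\dim\mathrm{RM}_{d-1}(2),\\ B_{\alpha_0,0}&\text{if } r>\dim\mathrm{RM}_{d-1}(2),\end{cases}$$ where $$H_{\alpha_0,0}=\begin{cases}d_r(\mathrm{RM}_d(2))+q^s-d+\mu_0&\text{if }\alpha_0\le\lambda,\\ d_{r-\lambda}(\mathrm{RM}_{d-1}(2))+q^s-d+\lambda&\text{if }\alpha_0>\lambda.\end{cases}$$ (b) Suppose $d\ge q^s$, and let $\lambda=\min\{q^s+1,r\}$ and $$E=\{\gamma\in\mathbb{Z}:\max\{r-\dim\mathrm{RM}_d(2),0\}\le\gamma\le\min\{d-q^s+2,r\}\}.$$ Then $E\neq\emptyset$ and $$\min_{(\alpha,\gamma)\in Y}B_{\alpha,\gamma}=\begin{cases}\min\{B_{0,0},\min_{\gamma\in E}H_{\alpha_\gamma,\gamma}\}&\text{if } r\le\dim\mathrm{RM}_{d-1}(2),\\ \min_{\gamma\in E}H_{\alpha_\gamma,\gamma}&\text{if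 } r>\dim\mathrm{RM}_{d-1}(2),\end{cases}$$ where $$H_{\alpha_\gamma,\gamma}=\begin{cases}d_r(\mathrm{RM}_d(2))+\mu_0&\text{if }\gamma=0,\ \alpha_\gamma\le\lambda,\\ d_{r-\lambda}(\mathrm{RM}_{d-1}(2))+\lambda&\text{if }\gamma=0,\ \alpha_\gamma>\lambda,\\ d_{r-\gamma}(\mathrm{RM}_d(2))+\max\{\mu_\gamma,2q^s-d+\gamma-1\}&\text{if }\gamma>0,\ \alpha_\gamma\le\lambda,\\ d_{r-\lambda}(\mathrm{RM}_{d-1}(2))+\max\{\lambda,2q^s-d+\gamma-1\}&\text{if }\gamma>0,\ \alpha_\gamma>\lambda.\end{cases}$$ Moreover, in both cases the bound is sharp, i.e. $d_r(\mathrm{PRM}_d(2))=\min_{(\alpha,\gamma)\in Y}B_{\alpha,\gamma}$, if either $r\le\dim\mathrm{RM}_{d-1}(2)$ and $\min_{(\alpha,\gamma)\in Y}B_{\alpha,\gamma}=d_r(\mathrm{RM}_{d-1}(2))$, or $r\le\min\{d+1,q^s+1\}$ and $\min_{(\alpha,\gamma)\in Y}B_{\alpha,\gamma}=q^s\cdot\max\{q^s-d+r,r\}$.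 -/

import Mathlib

open Module MvPolynomial

noncomputable section

/-- The support of a set `D` of words: the coordinates at which some word of `D` is nonzero. -/
def codeSupport {F ι : Type*} [Field F] (D : Submodule F (ι → F)) : Set ι :=
  {i | ∃ c ∈ D, c i ≠ 0}

/-- The `r`-th generalized Hamming weight of a linear code `C`: the minimum size of the support of
an `r`-dimensional subcode. It is meaningful for `0 ≤ r ≤ dim C` (and it is `0` for `r = 0`). -/
def ghw {F ι : Type*} [Field F] (C : Submodule F (ι → F)) (r : ℕ) : ℕ :=
  sInf {n | ∃ D : Submodule F (ι → F), D ≤ C ∧ finrank F D = r ∧ n = (codeSupport D).ncard}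

/-- The chosen representatives of the points of the projective space `ℙ^m` over `F`: the vectors
of `F^(m+1)` whose first nonzero coordinate from the left is `1`. -/
def ProjPts (F : Type*) [Field F] (m : ℕ) : Type _ :=
  {x : Fin (m + 1) → F // ∃ i, x i = 1 ∧ ∀ j < i, x j = 0}

/-- Evaluation of polynomials in `n` variables at the points of a family `p` in `F^n`. -/
def evalMap {F ι : Type*} [Field F] {n : ℕ} (p : ι → Fin n → F) :
    MvPolynomial (Fin n) F →ₗ[F] (ι → F) :=
  LinearMap.pi fun i => (MvPolynomial.aeval (R := F) (p i)).toLinearMap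

/-- The affine Reed-Muller code `RM_d(m)` over `F`: evaluations at all points of `F^m` of the
polynomials in `m` variables of total degree at most `d`. -/
def RM (F : Type*) [Field F] (d m : ℕ) : Submodule F ((Fin m → F) → F) :=
  (restrictTotalDegree (Fin m) F d).map (evalMap fun x : Fin m → F => x)

/-- The projective Reed-Muller code `PRM_d(m)` over `F`: evaluations at the representatives of the
points of `ℙ^m` of the homogeneous polynomials of degree `d`, with the convention that it is
`{0}` for `d ≤ 0` (a negative degree is represented by the truncated value `0`). -/
def PRM (F : Type*) [Field F] (d m : ℕ) : Submodule F (ProjPts F m → F) :=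
  if d = 0 then ⊥
  else (homogeneousSubmodule (Fin (m + 1)) F d).map
    (evalMap fun x : ProjPts F m => (x.1 : Fin (m + 1) → F))

namespace PlaneBound

variable (F : Type*) [Field F] [Fintype F] (d r : ℕ)

/-- The index set `Y` of pairs `(α, γ)`, over `ℙ²`. -/
def Y : Set (ℕ × ℕ) :=
  {p | max (r - finrank F (RM F (d - 1) 2)) 0 ≤ p.1 ∧ p.1 ≤ min (finrank F (PRM F d 1)) r ∧
    max (r - finrank F (RM F d 2)) 0 ≤ p.2 ∧
    p.2 ≤ min (finrank F (PRM F (d - (Fintype.card F - 1)) 1)) p.1}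

/-- The quantity `B_{α,γ}`, over `ℙ²`. -/
def B (a g : ℕ) : ℕ :=
  max (ghw (RM F d 2) (r - g)) (ghw (RM F (d - 1) 2) (r - a)) +
    max (ghw (PRM F d 1) a) (ghw (PRM F (d - (Fintype.card F - 1)) 1) g)

/-- The bound `min_{(α,γ) ∈ Y} B_{α,γ}`. -/
def minB : ℕ := sInf ((fun p : ℕ × ℕ => B F d r p.1 p.2) '' Y F d r)

/-- `α_i`: the smallest integer `α` with `i ≤ α ≤ r` such that
`d_{r-α}(RM_{d-1}(2)) ≤ d_{r-i}(RM_d(2))`. The clause `r - α ≤ dim RM_{d-1}(2)` says that the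
weight on the left exists. -/
def alphaIdx (i : ℕ) : ℕ :=
  sInf {a | i ≤ a ∧ a ≤ r ∧ r - a ≤ finrank F (RM F (d - 1) 2) ∧
    ghw (RM F (d - 1) 2) (r - a) ≤ ghw (RM F d 2) (r - i)}

/-- `μ_i = max {α_i, r - dim RM_{d-1}(2)}`. -/
def muIdx (i : ℕ) : ℕ := max (alphaIdx F d r i) (r - finrank F (RM F (d - 1) 2))

/-- `H_{α_0,0}` in the case `d < q^s`, where `λ = min {d + 1, r}`. -/
def HLow : ℕ :=
  if alphaIdx F d r 0 ≤ min (d + 1) r then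
    ghw (RM F d 2) r + (Fintype.card F - d) + muIdx F d r 0
  else
    ghw (RM F (d - 1) 2) (r - min (d + 1) r) + (Fintype.card F - d) + min (d + 1) r

/-- The index set `E` of the case `d ≥ q^s`. -/
def E : Set ℕ :=
  {g | max (r - finrank F (RM F d 2)) 0 ≤ g ∧ g ≤ min (d - Fintype.card F + 2) r}

/-- `H_{α_γ,γ}` in the case `q^s ≤ d ≤ 2(q^s - 1)`, where `λ = min {q^s + 1, r}`. -/
def HHigh (g : ℕ) : ℕ :=
  let lam := min (Fintype.card F + 1) r
  if g = 0 then
    if alphaIdx F d r 0 ≤ lam then ghw (RM F d 2) r + muIdx F d r 0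
    else ghw (RM F (d - 1) 2) (r - lam) + lam
  else
    if alphaIdx F d r g ≤ lam then
      ghw (RM F d 2) (r - g) + max (muIdx F d r g) (2 * Fintype.card F - d + g - 1)
    else
      ghw (RM F (d - 1) 2) (r - lam) + max lam (2 * Fintype.card F - d + g - 1)

end PlaneBound

end

/-! Write `Q` for the cardinality of `F`. The lower bound comes from splitting the projective plane
into its affine chart and its line at infinity. Let `D` be an `r`-dimensional subcode of `PRM F d
2`, let `α` be the dimension of its restriction to infinity and `γ` that of the subcode vanishing on
the chart. The restriction to the chart has dimension `r - γ` and lies in RM of degree `d`; the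
words vanishing at infinity have dimension `r - α` and restrict into RM of degree `d - 1`. Likewise
`α` and `γ` are dimensions of subcodes of PRM over the line, of degrees `d` and `d - (Q - 1)`.
Adding the two support sizes gives `B` (`exists_le_ncard_codeSupport`).

The closed forms rest on two facts. The code `PRM F d 1` is MDS, so its weights are explicit
(`ghw_PRM_one`). For fixed `γ`, the choice `α = α_γ` is optimal (`ghw_add_max_alphaIdx_le`): a
larger `α` gains nothing on the affine part, and each unit below `α_γ` costs at least one there, by
strict monotonicity of the weights. Since RM of degree `d - 1` has small codimension in RM of degree
`d`, always `α_γ ≤ λ` (`alphaIdx_le_min`), so the branches with `α_γ > λ` never occur.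

Sharpness comes from two constructions: extending affine words by zero, and taking cones over codes
on the line. -/

/-! ### Generalized Hamming weights: strict monotonicity and the Singleton bound. -/

section GeneralizedHammingWeights

variable {F ι : Type*} [Field F]

theorem Submodule.exists_le_finrank_eq {V : Type*} [AddCommGroup V] [Module F V]
    [FiniteDimensional F V] (C : Submodule F V) {r : ℕ} (hr : r ≤ finrank F C) :
    ∃ D ≤ C, finrank F D = r := by
  let b := finBasis F C
  have hli : LinearIndependent F fun i : Fin r => (b (Fin.castLE hr i) : V) :=
    (b.linearIndependent.map' C.subtype C.ker_subtype).comp _ (Fin.castLE_injective hr)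
  refine ⟨Submodule.span F (Set.range fun i : Fin r => (b (Fin.castLE hr i) : V)), ?_, ?_⟩
  · rw [Submodule.span_le]
    rintro _ ⟨i, rfl⟩
    exact (b _).2
  · rw [finrank_span_eq_card hli, Fintype.card_fin]

/-- Rank-nullity for the restriction of a linear map to a subspace. -/
theorem finrank_map_add_finrank_inf_ker {V W : Type*} [AddCommGroup V] [Module F V]
    [AddCommGroup W] [Module F W] [FiniteDimensional F V] (f : V →ₗ[F] W) (D : Submodule F V) :
    finrank F (D.map f) + finrank F ↥(D ⊓ LinearMap.ker f) = finrank F D := by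
  rw [← LinearMap.finrank_range_add_finrank_ker (f.domRestrict D), LinearMap.range_domRestrict,
    LinearMap.ker_domRestrict]
  congr 1
  rw [← Submodule.map_comap_subtype]
  exact Submodule.finrank_map_subtype_eq D _

theorem codeSupport_mono {D D' : Submodule F (ι → F)} (h : D ≤ D') :
    codeSupport D ⊆ codeSupport D' :=
  fun _ ⟨c, hc, hi⟩ => ⟨c, h hc, hi⟩

theorem codeSupport_bot : codeSupport (⊥ : Submodule F (ι → F)) = ∅ := by
  ext i
  simp [codeSupport]

theorem ghw_le {C D : Submodule F (ι → F)} {r : ℕ} (hD : D ≤ C) (hr : finrank F D = r) :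
    ghw C r ≤ (codeSupport D).ncard :=
  Nat.sInf_le ⟨D, hD, hr, rfl⟩

theorem ghw_zero (C : Submodule F (ι → F)) : ghw C 0 = 0 := by
  have := ghw_le (C := C) bot_le (finrank_bot F (ι → F))
  simpa [codeSupport_bot] using this

variable [Finite ι]

theorem exists_ghw {C : Submodule F (ι → F)} {r : ℕ} (hr : r ≤ finrank F C) :
    ∃ D ≤ C, finrank F D = r ∧ ghw C r = (codeSupport D).ncard := by
  obtain ⟨D, hD, h⟩ := C.exists_le_finrank_eq hr
  exact Nat.sInf_mem (s := {n | ∃ D : Submodule F (ι → F), D ≤ C ∧ finrank F D = r ∧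
    n = (codeSupport D).ncard}) ⟨_, D, hD, h, rfl⟩

theorem ghw_le_of_le_finrank {C D : Submodule F (ι → F)} {r : ℕ} (hD : D ≤ C)
    (hr : r ≤ finrank F D) : ghw C r ≤ (codeSupport D).ncard := by
  obtain ⟨D', hD', h⟩ := D.exists_le_finrank_eq hr
  exact (ghw_le (hD'.trans hD) h).trans
    (Set.ncard_le_ncard (codeSupport_mono hD') (Set.toFinite _))

theorem ghw_anti {C C' : Submodule F (ι → F)} {r : ℕ} (h : C ≤ C') (hr : r ≤ finrank F C) :
    ghw C' r ≤ ghw C r := by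
  obtain ⟨D, hD, h', h''⟩ := exists_ghw hr
  exact h'' ▸ ghw_le (hD.trans h) h'

/-- Imposing vanishing at one coordinate of the support lowers the dimension by at most one and
shrinks the support. -/
theorem ghw_lt_succ {C : Submodule F (ι → F)} {r : ℕ} (hr : r + 1 ≤ finrank F C) :
    ghw C r < ghw C (r + 1) := by
  obtain ⟨D, hD, h, h'⟩ := exists_ghw hr
  have hne : D ≠ ⊥ := by
    rintro rfl
    simp at h
  obtain ⟨c, hc, hc0⟩ := D.exists_mem_ne_zero_of_ne_bot hne
  obtain ⟨i, hi⟩ := Function.ne_iff.mp hc0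
  have hk := finrank_map_add_finrank_inf_ker (LinearMap.proj i : (ι → F) →ₗ[F] F) D
  have h1 := Submodule.finrank_le (D.map (LinearMap.proj i : (ι → F) →ₗ[F] F))
  rw [finrank_self] at h1
  rw [h']
  refine (ghw_le_of_le_finrank (D := D ⊓ LinearMap.ker (LinearMap.proj i))
    (inf_le_left.trans hD) (by omega)).trans_lt (Set.ncard_lt_ncard ?_ (Set.toFinite _))
  refine ⟨codeSupport_mono inf_le_left, fun hsub => ?_⟩
  obtain ⟨c', hc', hi'⟩ := hsub (show i ∈ codeSupport D from ⟨c, hc, hi⟩)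
  exact hi' hc'.2

theorem ghw_add_le {C : Submodule F (ι → F)} {r k : ℕ} (hr : r + k ≤ finrank F C) :
    ghw C r + k ≤ ghw C (r + k) := by
  induction k with
  | zero => rfl
  | succ k ih =>
    have := ghw_lt_succ (C := C) (r := r + k) hr
    have := ih (by omega)
    rw [← add_assoc r]
    omega

theorem ghw_mono {C : Submodule F (ι → F)} {r r' : ℕ} (h : r ≤ r') (hr : r' ≤ finrank F C) :
    ghw C r + (r' - r) ≤ ghw C r' := by
  have := ghw_add_le (C := C) (r := r) (k := r' - r) (by omega)
  rwa [Nat.add_sub_cancel' h] at this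

/-- The generalized Singleton bound: the weights increase strictly up to the top one, which is at
most the length. -/
theorem ghw_add_finrank_le {C : Submodule F (ι → F)} {r : ℕ} (hr : r ≤ finrank F C) :
    ghw C r + finrank F C ≤ Nat.card ι + r := by
  have h := ghw_mono hr le_rfl
  obtain ⟨D, -, -, hD⟩ := exists_ghw (le_refl (finrank F C))
  have := Set.ncard_le_card (codeSupport D)
  omega

/-- A subspace of codimension at most `k` in `C'` meets every `r`-dimensional subcode in dimension
at least `r - k`. -/
theorem ghw_sub_le_of_finrank_le {C C' : Submodule F (ι → F)} {r k : ℕ} (h : C ≤ C')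
    (hk : finrank F C' ≤ finrank F C + k) (hr : r ≤ finrank F C') :
    ghw C (r - k) ≤ ghw C' r := by
  obtain ⟨D, hD, h', h''⟩ := exists_ghw hr
  rw [h'']
  have h1 := Submodule.finrank_sup_add_finrank_inf_eq D C
  have h2 : finrank F ↥(D ⊔ C) ≤ finrank F C' := Submodule.finrank_mono (sup_le hD h)
  exact (ghw_le_of_le_finrank (D := D ⊓ C) inf_le_right (by omega)).trans
    (Set.ncard_le_ncard (codeSupport_mono inf_le_left) (Set.toFinite _))

/-- A lower bound for the higher weights from the minimum distance. -/
theorem le_ghw_of_forall_le {C : Submodule F (ι → F)} {r w : ℕ} (hr₁ : 1 ≤ r)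
    (hr : r ≤ finrank F C) (hw : ∀ c ∈ C, c ≠ 0 → w ≤ {i | c i ≠ 0}.ncard) :
    w + (r - 1) ≤ ghw C r := by
  have h := ghw_mono hr₁ hr
  obtain ⟨D, hD, h', h''⟩ := exists_ghw (hr₁.trans hr)
  have hne : D ≠ ⊥ := by
    rintro rfl
    simp at h'
  obtain ⟨c, hc, hc0⟩ := D.exists_mem_ne_zero_of_ne_bot hne
  have := (hw c (hD hc) hc0).trans
    (Set.ncard_le_ncard (show {i | c i ≠ 0} ⊆ codeSupport D from fun i hi => ⟨c, hc, hi⟩)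
      (Set.toFinite _))
  omega

end GeneralizedHammingWeights

/-! ### Reed-Muller codes and their restrictions to the affine chart and to infinity. -/

section ReedMuller

variable {F : Type*} [Field F]

theorem mem_RM {d m : ℕ} {c : (Fin m → F) → F} :
    c ∈ RM F d m ↔ ∃ g : MvPolynomial (Fin m) F, g.totalDegree ≤ d ∧ ∀ x, c x = eval x g := by
  simp only [RM, Submodule.mem_map, mem_restrictTotalDegree]
  refine exists_congr fun g => and_congr_right fun _ => ?_
  rw [eq_comm, funext_iff]
  rfl

theorem RM_mono {d d' : ℕ} (h : d ≤ d') (m : ℕ) : RM F d m ≤ RM F d' m := fun c hc => by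
  obtain ⟨g, hg, hc⟩ := mem_RM.mp hc
  exact mem_RM.mpr ⟨g, hg.trans h, hc⟩

theorem mem_PRM {d m : ℕ} (hd : d ≠ 0) {c : ProjPts F m → F} :
    c ∈ PRM F d m ↔ ∃ f : MvPolynomial (Fin (m + 1)) F, f.IsHomogeneous d ∧
      ∀ x, c x = eval x.1 f := by
  simp only [PRM, if_neg hd, Submodule.mem_map, mem_homogeneousSubmodule]
  refine exists_congr fun g => and_congr_right fun _ => ?_
  rw [eq_comm, funext_iff]
  rfl

theorem PRM_zero (m : ℕ) : PRM F 0 m = ⊥ := if_pos rfl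

namespace ProjPts

instance [Finite F] (m : ℕ) : Finite (ProjPts F m) := by
  unfold ProjPts
  infer_instance

/-- The representative `(1, x)` of a point of the affine chart. -/
def aff {m : ℕ} (x : Fin m → F) : ProjPts F m :=
  ⟨Fin.cons 1 x, 0, rfl, fun _ hj => absurd hj (Fin.not_lt_zero _)⟩

/-- The representative `(0, y)` of a point of the hyperplane at infinity. -/
def inf {m : ℕ} (y : ProjPts F m) : ProjPts F (m + 1) :=
  ⟨Fin.cons 0 y.1, by
    obtain ⟨i, hi, hj⟩ := y.2
    refine ⟨i.succ, hi, fun j => ?_⟩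
    cases j using Fin.cases with
    | zero => exact fun _ => rfl
    | succ j => exact fun h => hj j (Fin.succ_lt_succ_iff.mp h)⟩

theorem aff_injective {m : ℕ} : Function.Injective (aff : (Fin m → F) → ProjPts F m) :=
  fun _ _ h => Fin.cons_right_injective (α := fun _ => F) _ (congrArg Subtype.val h)

theorem inf_injective {m : ℕ} : Function.Injective (inf : ProjPts F m → ProjPts F (m + 1)) :=
  fun _ _ h =>
  Subtype.ext (Fin.cons_right_injective (α := fun _ => F) _ (congrArg Subtype.val h))

theorem aff_ne_inf {m : ℕ} (x : Fin (m + 1) → F) (y : ProjPts F m) : aff x ≠ inf y := fun h =>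
  one_ne_zero (congrFun (congrArg Subtype.val h) 0)

theorem aff_or_inf {m : ℕ} (z : ProjPts F (m + 1)) : (∃ x, z = aff x) ∨ ∃ y, z = inf y := by
  obtain ⟨z, i, hi, hj⟩ := z
  cases i using Fin.cases with
  | zero =>
    refine Or.inl ⟨Fin.tail z, Subtype.ext ?_⟩
    change z = Fin.cons 1 (Fin.tail z)
    rw [← hi, Fin.cons_self_tail]
  | succ i =>
    refine Or.inr ⟨⟨Fin.tail z, i, hi, fun j h => hj j.succ (Fin.succ_lt_succ_iff.mpr h)⟩,
      Subtype.ext ?_⟩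
    change z = Fin.cons 0 (Fin.tail z)
    rw [← hj 0 (Fin.succ_pos i), Fin.cons_self_tail]

/-- A nonzero vector is a scalar multiple of the representative of its class. -/
theorem exists_eq_smul {m : ℕ} {x : Fin (m + 1) → F} (hx : x ≠ 0) :
    ∃ (a : F) (y : ProjPts F m), x = a • y.1 := by
  classical
  have hne : ∃ i, x i ≠ 0 := Function.ne_iff.mp hx
  obtain ⟨i, hi, hmin⟩ : ∃ i, x i ≠ 0 ∧ ∀ j < i, x j = 0 := by
    obtain ⟨i, hi, hmin⟩ := WellFounded.has_min (wellFounded_lt (α := Fin (m + 1)))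
      {i | x i ≠ 0} hne
    exact ⟨i, hi, fun j hj => by_contra fun h => hmin j h hj⟩
  refine ⟨x i, ⟨(x i)⁻¹ • x, i, by simp [hi], fun j hj => by simp [hmin j hj]⟩, ?_⟩
  simp [smul_smul, hi]

end ProjPts

theorem eval_cons_monomial {k : ℕ} (t : F) (x : Fin k → F) (e : Fin (k + 1) →₀ ℕ) (a : F) :
    eval (Fin.cons t x : Fin (k + 1) → F) (monomial e a) =
      t ^ e 0 * eval x (monomial e.tail a) := by
  rw [eval_monomial, eval_monomial, Finsupp.prod_fintype _ _ (by simp),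
    Finsupp.prod_fintype _ _ (by simp), Fin.prod_univ_succ]
  simp only [Fin.cons_zero, Fin.cons_succ, Finsupp.tail_apply]
  ring

theorem degree_eq_zero_add_tail {k : ℕ} (e : Fin (k + 1) →₀ ℕ) :
    e.degree = e 0 + e.tail.degree := by
  simp [Finsupp.degree_eq_sum, Fin.sum_univ_succ, Finsupp.tail_apply]

theorem homogeneousComponent_monomial {σ : Type*} (d : ℕ) (e : σ →₀ ℕ) (a : F) :
    homogeneousComponent d (monomial e a) = if e.degree = d then monomial e a else 0 := by
  rw [homogeneousComponent_of_mem ((mem_homogeneousSubmodule _ _).mpr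
    (isHomogeneous_monomial a rfl))]
  simp only [eq_comm]

/-- Dehomogenization: a projective Reed-Muller code in terms of polynomials of bounded degree. -/
theorem mem_PRM_succ {d m : ℕ} (hd : d ≠ 0) {c : ProjPts F (m + 1) → F} :
    c ∈ PRM F d (m + 1) ↔ ∃ g : MvPolynomial (Fin (m + 1)) F, g.totalDegree ≤ d ∧
      (∀ x, c (.aff x) = eval x g) ∧
      ∀ y, c (.inf y) = eval y.1 (homogeneousComponent d g) := by
  rw [mem_PRM hd]
  constructor
  · rintro ⟨f, hf, hc⟩
    -- Setting the first variable to `1` amounts to dropping its exponent.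
    refine ⟨∑ e ∈ f.support, monomial e.tail (coeff e f), ?_, fun x => ?_, fun y => ?_⟩
    · refine totalDegree_finsetSum_le fun e he => (totalDegree_monomial_le _ _).trans ?_
      have h1 := degree_eq_zero_add_tail e
      have h2 : e.degree = d := by
        by_contra h
        exact (mem_support_iff.mp he) (hf.coeff_eq_zero h)
      change e.tail.degree ≤ d
      omega
    · rw [hc, f.as_sum, map_sum, map_sum, ← f.as_sum]
      refine Finset.sum_congr rfl fun e _ => ?_
      exact (eval_cons_monomial 1 x e _).trans (by simp)
    · rw [hc, f.as_sum, map_sum, map_sum, map_sum, ← f.as_sum]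
      refine Finset.sum_congr rfl fun e he => ?_
      refine (eval_cons_monomial 0 y.1 e _).trans ?_
      have h1 := degree_eq_zero_add_tail e
      have h2 : e.degree = d := by
        by_contra h
        exact (mem_support_iff.mp he) (hf.coeff_eq_zero h)
      rw [homogeneousComponent_monomial]
      by_cases h : e 0 = 0
      · rw [if_pos (by omega), h, pow_zero, one_mul]
      · rw [if_neg (by omega), zero_pow h, zero_mul, map_zero]
  · rintro ⟨g, hg, hx, hy⟩
    have hdeg : ∀ e ∈ g.support, e.degree ≤ d := fun e he => (le_totalDegree he).trans hg
    -- Each monomial is homogenized by the missing power of the first variable.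
    refine ⟨∑ e ∈ g.support, monomial (Finsupp.cons (d - e.degree) e) (coeff e g), ?_,
      fun z => ?_⟩
    · refine IsHomogeneous.sum _ _ _ fun e he => isHomogeneous_monomial _ ?_
      rw [degree_eq_zero_add_tail, Finsupp.cons_zero, Finsupp.tail_cons]
      have := hdeg e he
      omega
    · obtain ⟨x, rfl⟩ | ⟨y, rfl⟩ := z.aff_or_inf
      · rw [hx, g.as_sum, map_sum, map_sum, ← g.as_sum]
        refine Finset.sum_congr rfl fun e _ => ((eval_cons_monomial 1 x _ _).trans ?_).symm
        rw [one_pow, one_mul, Finsupp.tail_cons]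
      · rw [hy, g.as_sum, map_sum, map_sum, map_sum, ← g.as_sum]
        refine Finset.sum_congr rfl fun e he => ((eval_cons_monomial 0 y.1 _ _).trans ?_).symm
        rw [Finsupp.tail_cons, Finsupp.cons_zero, homogeneousComponent_monomial]
        have := hdeg e he
        split_ifs with h
        · rw [h, Nat.sub_self, pow_zero, one_mul]
        · rw [zero_pow (by omega), zero_mul, map_zero]

theorem homogeneousComponent_mul_of_isHomogeneous {σ : Type*} {p : MvPolynomial σ F} {n : ℕ}
    (hp : p.IsHomogeneous n) (k : ℕ) (h : MvPolynomial σ F) :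
    homogeneousComponent (n + k) (p * h) = p * homogeneousComponent k h := by
  conv_lhs => rw [← sum_homogeneousComponent h, Finset.mul_sum, map_sum]
  have : ∀ j, homogeneousComponent (n + k) (p * homogeneousComponent j h) =
      if k = j then p * homogeneousComponent j h else 0 := fun j => by
    rw [homogeneousComponent_of_mem ((mem_homogeneousSubmodule _ _).mpr
      (hp.mul (homogeneousComponent_isHomogeneous j h)))]
    simp
  simp only [this, Finset.sum_ite_eq, Finset.mem_range]
  split_ifs with hk
  · rfl
  · rw [homogeneousComponent_eq_zero _ _ (by omega), mul_zero]

theorem totalDegree_sub_homogeneousComponent_le {σ : Type*} {g : MvPolynomial σ F} {d : ℕ}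
    (hg : g.totalDegree ≤ d) : (g - homogeneousComponent d g).totalDegree ≤ d - 1 := by
  refine Finset.sup_le fun e he => ?_
  rw [MvPolynomial.mem_support_iff, coeff_sub, coeff_homogeneousComponent] at he
  have h1 : e.degree ≠ d := fun h => he (by rw [if_pos h, sub_self])
  rw [if_neg h1, sub_zero] at he
  have h2 : e.degree ≤ d := (le_totalDegree (MvPolynomial.mem_support_iff.mpr he)).trans hg
  change e.degree ≤ d - 1
  omega

/-- This identifies the vanishing polynomials of the full grid in the combinatorial Nullstellensatz.
-/
theorem FiniteField.prod_univ_X_sub_C (F : Type*) [Field F] [Fintype F] :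
    ∏ s : F, (Polynomial.X - Polynomial.C s) = (Polynomial.X ^ Fintype.card F - Polynomial.X) := by
  have hcard := Fintype.one_lt_card (α := F)
  have h := Polynomial.prod_multiset_X_sub_C_of_monic_of_roots_card_eq
    (Polynomial.monic_X_pow_sub (n := Fintype.card F) (p := (Polynomial.X : Polynomial F))
      (by rw [Polynomial.degree_X]; exact_mod_cast hcard))
    (by rw [FiniteField.roots_X_pow_card_sub_X,
      FiniteField.X_pow_card_sub_X_natDegree_eq F hcard]; rfl)
  rwa [FiniteField.roots_X_pow_card_sub_X] at h

variable {m d : ℕ}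

/-- Restriction of words to the affine chart. -/
def affRes (F : Type*) [Field F] (m : ℕ) : (ProjPts F m → F) →ₗ[F] ((Fin m → F) → F) :=
  LinearMap.funLeft F F ProjPts.aff

/-- Restriction of words to the hyperplane at infinity. -/
def infRes (F : Type*) [Field F] (m : ℕ) : (ProjPts F (m + 1) → F) →ₗ[F] (ProjPts F m → F) :=
  LinearMap.funLeft F F ProjPts.inf

theorem affRes_mem_RM (hd : d ≠ 0) {c : ProjPts F (m + 1) → F} (hc : c ∈ PRM F d (m + 1)) :
    affRes F (m + 1) c ∈ RM F d (m + 1) := by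
  obtain ⟨g, hg, hx, -⟩ := (mem_PRM_succ hd).mp hc
  exact mem_RM.mpr ⟨g, hg, hx⟩

theorem infRes_mem_PRM (hd : d ≠ 0) {c : ProjPts F (m + 1) → F} (hc : c ∈ PRM F d (m + 1)) :
    infRes F m c ∈ PRM F d m := by
  obtain ⟨g, hg, -, hy⟩ := (mem_PRM_succ hd).mp hc
  exact (mem_PRM hd).mpr ⟨_, homogeneousComponent_isHomogeneous d g, hy⟩

theorem eval_smul_of_isHomogeneous {σ : Type*} {f : MvPolynomial σ F} (hf : f.IsHomogeneous d)
    (a : F) (x : σ → F) : eval (a • x) f = a ^ d * eval x f := by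
  rw [f.as_sum, map_sum, map_sum, Finset.mul_sum]
  refine Finset.sum_congr rfl fun e he => ?_
  have h2 : e.degree = d := by
    by_contra h
    exact (mem_support_iff.mp he) (hf.coeff_eq_zero h)
  rw [eval_monomial, eval_monomial, ← h2, Finsupp.degree_apply]
  simp only [Finsupp.prod, Pi.smul_apply, smul_eq_mul, mul_pow, Finset.prod_mul_distrib,
    Finset.prod_pow_eq_pow_sum]
  ring

/-- The values at infinity are those of the top component. If they vanish, that component is zero as
a function by homogeneity, and removing it lowers the degree without changing the affine word. -/
theorem affRes_mem_RM_of_infRes_eq_zero (hd : d ≠ 0) {c : ProjPts F (m + 1) → F}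
    (hc : c ∈ PRM F d (m + 1)) (h0 : infRes F m c = 0) :
    affRes F (m + 1) c ∈ RM F (d - 1) (m + 1) := by
  obtain ⟨g, hg, hx, hy⟩ := (mem_PRM_succ hd).mp hc
  have hzero : ∀ x, eval x (homogeneousComponent d g) = 0 := fun x => by
    have hh := homogeneousComponent_isHomogeneous d g
    by_cases hx : x = 0
    · rw [hx, ← zero_smul F (0 : Fin (m + 1) → F), eval_smul_of_isHomogeneous hh, zero_pow hd,
        zero_mul]
    · obtain ⟨a, y, rfl⟩ := ProjPts.exists_eq_smul hx
      rw [eval_smul_of_isHomogeneous hh, ← hy y, show c (.inf y) = 0 from congrFun h0 y, mul_zero]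
  refine mem_RM.mpr ⟨_, totalDegree_sub_homogeneousComponent_le hg, fun x => ?_⟩
  rw [map_sub, hzero, sub_zero]
  exact hx x

/-- A polynomial vanishing on the whole affine space is a combination of the `X i ^ Q - X i`, with
control of degrees. Its top component is then a combination of the `X i ^ Q`, and replacing `X i ^
Q` by `X i` keeps the values while lowering the degree by `Q - 1`. -/
theorem infRes_mem_PRM_of_affRes_eq_zero [Fintype F] (hd : d ≠ 0) {c : ProjPts F (m + 1) → F}
    (hc : c ∈ PRM F d (m + 1)) (h0 : affRes F (m + 1) c = 0) :
    infRes F m c ∈ PRM F (d - (Fintype.card F - 1)) m := by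
  obtain ⟨g, hg, hx, hy⟩ := (mem_PRM_succ hd).mp hc
  have hcard := Fintype.one_lt_card (α := F)
  obtain ⟨h, hdeg, hsum⟩ := combinatorial_nullstellensatz_exists_linearCombination
    (fun _ : Fin (m + 1) => (Finset.univ : Finset F)) (fun _ => Finset.univ_nonempty) g
    fun x _ => (hx x).symm.trans (congrFun h0 x)
  have hprod : ∀ i : Fin (m + 1), ∏ s : F, (X i - C s) =
      (X i ^ Fintype.card F - X i : MvPolynomial (Fin (m + 1)) F) := fun i => by
    have := congrArg (Polynomial.aeval (X i : MvPolynomial (Fin (m + 1)) F))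
      (FiniteField.prod_univ_X_sub_C F)
    simpa [map_prod] using this
  simp only [hprod] at hdeg hsum
  rw [Finsupp.linearCombination_apply, Finsupp.sum_fintype _ _ (by simp)] at hsum
  simp only [smul_eq_mul] at hsum
  have hdegX : ∀ i : Fin (m + 1),
      (X i ^ Fintype.card F - X i : MvPolynomial (Fin (m + 1)) F).totalDegree =
        Fintype.card F := fun i => by
    rw [sub_eq_add_neg, totalDegree_add_eq_left_of_totalDegree_lt, totalDegree_X_pow]
    rw [totalDegree_neg, totalDegree_X_pow, totalDegree_X]
    exact hcard
  have hdeg' : ∀ i, h i ≠ 0 → Fintype.card F + (h i).totalDegree ≤ d := fun i hi => by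
    have hne : (X i ^ Fintype.card F - X i : MvPolynomial (Fin (m + 1)) F) ≠ 0 := fun h => by
      have := hdegX i
      rw [h, totalDegree_zero] at this
      omega
    rw [← hdegX i, ← totalDegree_mul_of_isDomain hne hi]
    exact (hdeg i).trans hg
  by_cases hQ : d < Fintype.card F
  · have hg0 : g = 0 := by
      rw [hsum]
      refine Finset.sum_eq_zero fun i _ => ?_
      by_cases hi : h i = 0
      · rw [hi, zero_mul]
      · have := hdeg' i hi
        omega
    have : infRes F m c = 0 := funext fun y => (hy y).trans (by rw [hg0, map_zero, map_zero]; rfl)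
    rw [this]
    exact zero_mem _
  · obtain ⟨k, rfl⟩ := Nat.exists_eq_add_of_le (not_lt.mp hQ)
    -- Only `X i ^ Q` reaches degree `d = Q + k`; the product of `h i` with `X i` has smaller
    -- degree.
    have hcomp : ∀ i, homogeneousComponent (Fintype.card F + k)
        (h i * (X i ^ Fintype.card F - X i)) =
          X i ^ Fintype.card F * homogeneousComponent k (h i) := fun i => by
      by_cases hi : h i = 0
      · simp [hi]
      · have h1 := hdeg' i hi
        rw [mul_comm, sub_mul, map_sub,
          homogeneousComponent_mul_of_isHomogeneous (isHomogeneous_X_pow i _),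
          homogeneousComponent_eq_zero _ (X i * h i), sub_zero]
        refine (totalDegree_mul _ _).trans_lt ?_
        rw [totalDegree_X]
        omega
    refine (mem_PRM (by omega)).mpr ⟨∑ i, X i * homogeneousComponent k (h i), ?_, fun y => ?_⟩
    · refine IsHomogeneous.sum _ _ _ fun i _ => ?_
      rw [show Fintype.card F + k - (Fintype.card F - 1) = 1 + k by omega]
      exact (isHomogeneous_X F i).mul (homogeneousComponent_isHomogeneous k (h i))
    · refine (hy y).trans ?_
      rw [hsum, map_sum, map_sum, map_sum]
      refine Finset.sum_congr rfl fun i _ => ?_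
      rw [hcomp, map_mul, map_mul, map_pow, eval_X, FiniteField.pow_card]

/-- Words of the affine code of degree `d - 1`, extended by zero to infinity. -/
theorem mem_PRM_of_affRes_mem_RM (hd : d ≠ 0) {c : ProjPts F (m + 1) → F}
    (hc : affRes F (m + 1) c ∈ RM F (d - 1) (m + 1)) (h0 : infRes F m c = 0) :
    c ∈ PRM F d (m + 1) := by
  obtain ⟨g, hg, hx⟩ := mem_RM.mp hc
  refine (mem_PRM_succ hd).mpr ⟨g, by omega, hx, fun y => ?_⟩
  rw [homogeneousComponent_eq_zero _ _ (by omega), map_zero]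
  exact congrFun h0 y

end ReedMuller

/-! ### Dimension and weights of the codes on the projective line. -/

section ProjectiveLine

variable {F : Type*} [Field F]

theorem ProjPts.ncard_eq [Finite F] {m : ℕ} (S : Set (ProjPts F (m + 1))) :
    S.ncard = (aff ⁻¹' S).ncard + (inf ⁻¹' S).ncard := by
  have hS : S = aff '' (aff ⁻¹' S) ∪ inf '' (inf ⁻¹' S) := by
    ext z
    constructor
    · obtain ⟨x, rfl⟩ | ⟨y, rfl⟩ := z.aff_or_inf
      · exact fun h => Or.inl ⟨x, h, rfl⟩
      · exact fun h => Or.inr ⟨y, h, rfl⟩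
    · rintro (⟨x, h, rfl⟩ | ⟨y, h, rfl⟩) <;> exact h
  have hdis : Disjoint (aff '' (aff ⁻¹' S)) (inf '' (inf ⁻¹' S)) := by
    rw [Set.disjoint_left]
    rintro _ ⟨x, -, rfl⟩ ⟨y, -, h⟩
    exact aff_ne_inf x y h.symm
  conv_lhs => rw [hS]
  rw [Set.ncard_union_eq hdis (Set.toFinite _) (Set.toFinite _),
    Set.ncard_image_of_injective _ aff_injective, Set.ncard_image_of_injective _ inf_injective]

theorem codeSupport_map_funLeft {ι κ : Type*} (p : κ → ι) (D : Submodule F (ι → F)) :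
    codeSupport (D.map (LinearMap.funLeft F F p)) = p ⁻¹' codeSupport D := by
  ext i
  constructor
  · rintro ⟨_, ⟨c, hc, rfl⟩, hi⟩
    exact ⟨c, hc, hi⟩
  · rintro ⟨c, hc, hi⟩
    exact ⟨_, ⟨c, hc, rfl⟩, hi⟩

theorem ncard_codeSupport_eq [Finite F] {m : ℕ} (D : Submodule F (ProjPts F (m + 1) → F)) :
    (codeSupport D).ncard = (codeSupport (D.map (affRes F (m + 1)))).ncard +
      (codeSupport (D.map (infRes F m))).ncard := by
  rw [affRes, infRes, codeSupport_map_funLeft, codeSupport_map_funLeft, ProjPts.ncard_eq]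

theorem eq_zero_of_affRes_infRes {m : ℕ} {c : ProjPts F (m + 1) → F}
    (h : affRes F (m + 1) c = 0) (h' : infRes F m c = 0) : c = 0 := by
  funext z
  obtain ⟨x, rfl⟩ | ⟨y, rfl⟩ := z.aff_or_inf
  · exact congrFun h x
  · exact congrFun h' y

theorem ProjPts.apply_zero (y : ProjPts F 0) : y.1 0 = 1 := by
  obtain ⟨i, hi, -⟩ := y.2
  rwa [Subsingleton.elim (α := Fin 1) i 0] at hi

instance : Unique (ProjPts F 0) where
  default := .aff 0
  uniq y := Subtype.ext <| funext fun i => by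
    rw [Subsingleton.elim (α := Fin 1) i 0, y.apply_zero, ProjPts.apply_zero]

theorem ProjPts.card_one [Fintype F] : Nat.card (ProjPts F 1) = Fintype.card F + 1 := by
  have h : Nat.card (Fin 1 → F) = Fintype.card F := by simp
  rw [← Set.ncard_univ, ProjPts.ncard_eq, Set.preimage_univ, Set.preimage_univ, Set.ncard_univ,
    Set.ncard_univ, Nat.card_unique (α := ProjPts F 0), ← h]

/-- A nonzero univariate polynomial of degree at most `d` has at most `d` roots. -/
theorem card_le_ncard_support_add [Fintype F] {d : ℕ} {c : (Fin 1 → F) → F} (hc : c ∈ RM F d 1)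
    (h0 : c ≠ 0) : Fintype.card F ≤ {x | c x ≠ 0}.ncard + d := by
  classical
  obtain ⟨g, hg, hx⟩ := mem_RM.mp hc
  set p : Polynomial F := MvPolynomial.aeval (fun _ : Fin 1 => (Polynomial.X : Polynomial F)) g
    with hp
  have hdeg : p.natDegree ≤ d := by
    simpa using aeval_natDegree_le g hg _ (fun _ => Polynomial.natDegree_X_le)
  have heval : ∀ x : Fin 1 → F, c x = p.eval (x 0) := fun x => by
    have h1 : (Polynomial.aeval (x 0)).comp
        (MvPolynomial.aeval (fun _ : Fin 1 => (Polynomial.X : Polynomial F))) =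
        MvPolynomial.aeval (R := F) x := by
      ext i
      simp [Subsingleton.elim i 0]
    have h2 := DFunLike.congr_fun h1 g
    rw [hx, ← MvPolynomial.coe_aeval_eq_eval, RingHom.coe_coe, ← h2, AlgHom.comp_apply,
      Polynomial.coe_aeval_eq_eval]
  have hp0 : p ≠ 0 := fun h => h0 (funext fun x => by rw [heval, h, Polynomial.eval_zero]; rfl)
  have hsub : {x | c x ≠ 0}ᶜ ⊆ (fun t (_ : Fin 1) => t) '' (p.roots.toFinset : Set F) := by
    intro x hx
    refine ⟨x 0, ?_, funext fun i => by rw [Subsingleton.elim i 0]⟩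
    rw [Finset.mem_coe, Multiset.mem_toFinset, Polynomial.mem_roots hp0, Polynomial.IsRoot,
      ← heval]
    simpa using hx
  have h1 := Set.ncard_add_ncard_compl {x | c x ≠ 0}
  have h2 := (Set.ncard_le_ncard hsub (Set.toFinite _)).trans
    (Set.ncard_image_le (Set.toFinite _))
  rw [Set.ncard_coe_finset] at h2
  have h3 := (Multiset.toFinset_card_le p.roots).trans p.card_roots'
  have h4 : Nat.card (Fin 1 → F) = Fintype.card F := by simp
  omega

/-- A zero at infinity lowers the affine degree by one; otherwise the point at infinity itself
supplies the extra `1`. -/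
theorem le_ncard_support_of_mem_PRM_one [Fintype F] {d : ℕ} (hd : d ≠ 0) {c : ProjPts F 1 → F}
    (hc : c ∈ PRM F d 1) (h0 : c ≠ 0) : Fintype.card F - d + 1 ≤ {z | c z ≠ 0}.ncard := by
  have hsplit : {z | c z ≠ 0}.ncard =
      {x | affRes F 1 c x ≠ 0}.ncard + {y | infRes F 0 c y ≠ 0}.ncard := ProjPts.ncard_eq _
  rw [hsplit]
  have hpos : ∀ {ι : Type _} [Finite ι] {u : ι → F}, u ≠ 0 → 0 < {i | u i ≠ 0}.ncard :=
    fun {ι} _ {u} hu => by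
      rw [Set.ncard_pos (Set.toFinite _)]
      exact Function.ne_iff.mp hu
  by_cases hi : infRes F 0 c = 0
  · have ha : affRes F 1 c ≠ 0 := fun h => h0 (eq_zero_of_affRes_infRes h hi)
    have hRM : affRes F 1 c ∈ RM F (d - 1) 1 := affRes_mem_RM_of_infRes_eq_zero hd hc hi
    have h1 := card_le_ncard_support_add hRM ha
    have h2 := hpos ha
    omega
  · have h1 : 0 < {y | infRes F 0 c y ≠ 0}.ncard := hpos hi
    by_cases ha : affRes F 1 c = 0
    · have h2 := infRes_mem_PRM_of_affRes_eq_zero hd hc ha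
      by_cases hQ : Fintype.card F ≤ d
      · omega
      · rw [Nat.sub_eq_zero_of_le (by omega), PRM_zero] at h2
        exact absurd h2 hi
    · have hRM : affRes F 1 c ∈ RM F d 1 := affRes_mem_RM hd hc
      have h2 := card_le_ncard_support_add hRM ha
      omega

theorem mem_PRM_one_of_natDegree_le {d : ℕ} (hd : d ≠ 0) {c : ProjPts F 1 → F}
    {p : Polynomial F} (hp : p.natDegree ≤ d) (hx : ∀ x, c (.aff x) = p.eval (x 0))
    (hy : ∀ y, c (.inf y) = p.coeff d) : c ∈ PRM F d 1 := by
  refine (mem_PRM_succ hd).mpr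
    ⟨∑ i ∈ Finset.range (d + 1), MvPolynomial.C (p.coeff i) * X 0 ^ i, ?_, fun x => ?_,
      fun y => ?_⟩
  · refine totalDegree_finsetSum_le fun i hi => ?_
    have := (isHomogeneous_C_mul_X_pow (p.coeff i) (0 : Fin 1) i).totalDegree_le
    have := Finset.mem_range.mp hi
    omega
  · rw [hx, Polynomial.eval_eq_sum_range' (Nat.lt_succ_of_le hp)]
    simp
  · rw [hy, map_sum, map_sum, Finset.sum_eq_single_of_mem d (by simp)]
    · rw [homogeneousComponent_of_mem ((mem_homogeneousSubmodule _ _).mpr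
        (isHomogeneous_C_mul_X_pow _ _ _)), if_pos rfl]
      simp [y.apply_zero]
    · intro i _ hi
      rw [homogeneousComponent_of_mem ((mem_homogeneousSubmodule _ _).mpr
        (isHomogeneous_C_mul_X_pow _ _ _)), if_neg (Ne.symm hi), map_zero]

/-- Values at `min d Q` affine points and at infinity can be prescribed independently, by Lagrange
interpolation. -/
theorem le_finrank_PRM_one [Fintype F] {d : ℕ} (hd : d ≠ 0) :
    min d (Fintype.card F) + 1 ≤ finrank F (PRM F d 1) := by
  classical
  obtain ⟨S, -, hS⟩ := Finset.exists_subset_card_eq (s := (Finset.univ : Finset F))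
    (n := min d (Fintype.card F)) (by simp)
  let φ : (ProjPts F 1 → F) →ₗ[F] (S → F) × F :=
    (LinearMap.funLeft F F fun s : S => ProjPts.aff fun _ => s.1).prod
      (LinearMap.proj (ProjPts.inf default))
  have hφ : (PRM F d 1).map φ = ⊤ := by
    rw [eq_top_iff]
    rintro ⟨v, b⟩ -
    let w : F → F := fun s => if h : s ∈ S then v ⟨s, h⟩ else 0
    -- `N` is monic of degree `d` and vanishes on `S`, so adding a multiple of it adjusts the value
    -- at infinity, the coefficient of `X ^ d`, without disturbing the values on `S`.
    let N : Polynomial F := Polynomial.X ^ (d - S.card) * ∏ s ∈ S, (Polynomial.X - Polynomial.C s)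
    have hprod : (∏ s ∈ S, (Polynomial.X - Polynomial.C s)).Monic :=
      Polynomial.monic_prod_of_monic _ _ fun s _ => Polynomial.monic_X_sub_C s
    have hN : N.Monic := (Polynomial.monic_X_pow _).mul hprod
    have hNdeg : N.natDegree = d := by
      rw [(Polynomial.monic_X_pow _).natDegree_mul hprod, Polynomial.natDegree_X_pow,
        Polynomial.natDegree_finsetProd_X_sub_C_eq_card]
      omega
    have hNroot : ∀ s ∈ S, N.eval s = 0 := fun s hs => by
      rw [Polynomial.eval_mul, Polynomial.eval_prod, Finset.prod_eq_zero hs (by simp), mul_zero]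
    let L := Lagrange.interpolate S id w
    have hLdeg : L.degree < d :=
      (Lagrange.degree_interpolate_lt w (Set.injOn_id _)).trans_le (by
        exact_mod_cast hS.trans_le (min_le_left _ _))
    let p := L + Polynomial.C b * N
    have hp : p.natDegree ≤ d := by
      refine (Polynomial.natDegree_add_le _ _).trans (max_le ?_ ?_)
      · exact Polynomial.natDegree_le_of_degree_le hLdeg.le
      · exact (Polynomial.natDegree_C_mul_le _ _).trans hNdeg.le
    let c : ProjPts F 1 → F := fun z => if z.1 0 = 0 then p.coeff d else p.eval (z.1 1)
    refine ⟨c, mem_PRM_one_of_natDegree_le hd hp (fun x => if_neg one_ne_zero)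
      (fun y => if_pos rfl), Prod.ext (funext fun s => ?_) ?_⟩
    · change c (.aff fun _ => s.1) = v s
      refine (if_neg one_ne_zero).trans ?_
      change p.eval s.1 = v s
      rw [Polynomial.eval_add, Polynomial.eval_mul, hNroot s s.2, mul_zero, add_zero]
      refine (Lagrange.eval_interpolate_at_node w (Set.injOn_id _) s.2).trans ?_
      simp [w]
    · change c (.inf default) = b
      refine (if_pos rfl).trans ?_
      have h1 : N.coeff d = 1 := by
        rw [← hNdeg]
        exact hN
      rw [Polynomial.coeff_add, Polynomial.coeff_eq_zero_of_degree_lt hLdeg,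
        Polynomial.coeff_C_mul, h1, mul_one, zero_add]
  have h := Submodule.finrank_map_le φ (PRM F d 1)
  rw [hφ, finrank_top, Module.finrank_prod, Module.finrank_fintype_fun_eq_card, finrank_self,
    Fintype.card_coe, hS] at h
  exact h

/-- The minimum distance forces the top weight up to at least `Q - d` plus the dimension, and this
weight is at most the length `Q + 1`. -/
theorem finrank_PRM_one [Fintype F] {d : ℕ} (hd : d ≠ 0) :
    finrank F (PRM F d 1) = min d (Fintype.card F) + 1 := by
  have h1 := le_finrank_PRM_one (F := F) hd
  have h2 := le_ghw_of_forall_le (by omega) le_rfl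
    fun c hc h0 => le_ncard_support_of_mem_PRM_one (F := F) hd hc h0
  have h3 := ghw_add_finrank_le (le_refl (finrank F (PRM F d 1)))
  rw [ProjPts.card_one] at h3
  omega

/-- The lower bound from the minimum distance meets the Singleton bound: the code is MDS. -/
theorem ghw_PRM_one [Fintype F] {d a : ℕ} (hd : d ≠ 0) (ha₁ : 1 ≤ a)
    (ha : a ≤ finrank F (PRM F d 1)) : ghw (PRM F d 1) a = Fintype.card F - d + a := by
  have h1 := le_ghw_of_forall_le ha₁ ha
    fun c hc h0 => le_ncard_support_of_mem_PRM_one (F := F) hd hc h0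
  have h2 := ghw_add_finrank_le ha
  rw [ProjPts.card_one, finrank_PRM_one hd] at h2
  omega

end ProjectiveLine

/-! ### The codimension of successive affine codes in the plane. -/

section ReedMullerPlane

variable {F : Type*} [Field F]

/-- The word of the monomial `x^a y^b`. -/
def monomialWord (F : Type*) [Field F] (a b : ℕ) : (Fin 2 → F) → F := fun x => x 0 ^ a * x 1 ^ b

theorem monomialWord_mem_RM {a b d : ℕ} (h : a + b ≤ d) : monomialWord F a b ∈ RM F d 2 := by
  refine mem_RM.mpr ⟨X 0 ^ a * X 1 ^ b, (totalDegree_mul _ _).trans ?_, fun x => ?_⟩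
  · rwa [totalDegree_X_pow, totalDegree_X_pow]
  · simp [monomialWord]

variable [Fintype F]

theorem pow_eq_pow_sub_card {n : ℕ} (h : Fintype.card F ≤ n) (t : F) :
    t ^ n = t ^ (n - (Fintype.card F - 1)) := by
  have hcard := Fintype.card_pos (α := F)
  obtain ⟨k, rfl⟩ := Nat.exists_eq_add_of_le h
  rw [pow_add, FiniteField.pow_card, show Fintype.card F + k - (Fintype.card F - 1) = k + 1 by omega,
    pow_succ, mul_comm]

open scoped Classical in
-- Since `t ^ Q = t`, a monomial with an exponent at least `Q` already has a representative of
-- degree at most `d - 1`. New words come only from monomials of degree exactly `d` with both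
-- exponents below `Q`, whence the range of `a`.
theorem RM_le_sup_span (d : ℕ) :
    RM F d 2 ≤ RM F (d - 1) 2 ⊔ Submodule.span F (Finset.image
      (fun a => monomialWord F a (d - a))
      (Finset.Icc (d + 1 - Fintype.card F) (min d (Fintype.card F - 1))) :
        Set ((Fin 2 → F) → F)) := by
  have hcard := Fintype.one_lt_card (α := F)
  intro c hc
  obtain ⟨g, hg, hx⟩ := mem_RM.mp hc
  have hsum : c = ∑ e ∈ g.support, coeff e g • monomialWord F (e 0) (e 1) := by
    funext x
    rw [hx, g.as_sum, map_sum, ← g.as_sum, Finset.sum_apply]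
    refine Finset.sum_congr rfl fun e _ => ?_
    rw [eval_monomial, Finsupp.prod_fintype _ _ (by simp), Fin.prod_univ_two]
    rfl
  rw [hsum]
  refine Submodule.sum_mem _ fun e he => Submodule.smul_mem _ _ ?_
  have hdeg : e 0 + e 1 ≤ d := by
    have h : e.degree ≤ d := (le_totalDegree he).trans hg
    rwa [Finsupp.degree_eq_sum, Fin.sum_univ_two] at h
  by_cases h0 : Fintype.card F ≤ e 0
  · refine Submodule.mem_sup_left ?_
    have : monomialWord F (e 0) (e 1) = monomialWord F (e 0 - (Fintype.card F - 1)) (e 1) :=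
      funext fun x => by rw [monomialWord, pow_eq_pow_sub_card h0]; rfl
    rw [this]
    exact monomialWord_mem_RM (by omega)
  by_cases h1 : Fintype.card F ≤ e 1
  · refine Submodule.mem_sup_left ?_
    have : monomialWord F (e 0) (e 1) = monomialWord F (e 0) (e 1 - (Fintype.card F - 1)) :=
      funext fun x => by rw [monomialWord, pow_eq_pow_sub_card h1]; rfl
    rw [this]
    exact monomialWord_mem_RM (by omega)
  by_cases h2 : e 0 + e 1 ≤ d - 1
  · exact Submodule.mem_sup_left (monomialWord_mem_RM h2)
  · refine Submodule.mem_sup_right (Submodule.subset_span ?_)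
    rw [Finset.mem_coe, Finset.mem_image]
    refine ⟨e 0, Finset.mem_Icc.mpr ⟨by omega, by omega⟩, ?_⟩
    rw [show d - e 0 = e 1 by omega]

theorem finrank_RM_two_le (d : ℕ) : finrank F (RM F d 2) ≤ finrank F (RM F (d - 1) 2) +
    (min d (Fintype.card F - 1) + 1 - (d + 1 - Fintype.card F)) := by
  classical
  refine (Submodule.finrank_mono (RM_le_sup_span d)).trans
    ((Submodule.finrank_add_le_finrank_add_finrank _ _).trans (Nat.add_le_add_left ?_ _))
  refine (finrank_span_finset_le_card (M := (Fin 2 → F) → F) _).trans (Finset.card_image_le.trans ?_)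
  rw [Nat.card_Icc]

end ReedMullerPlane

/-! ### Splitting a projective subcode, and the lower bound. -/

section Splitting

variable {F : Type*} [Field F] [Fintype F]

/-- A subcode of a projective Reed-Muller code is split by restriction to the affine chart and to
the hyperplane at infinity. -/
theorem exists_le_ncard_codeSupport {d m : ℕ} {D : Submodule F (ProjPts F (m + 1) → F)}
    (hd : d ≠ 0) (hD : D ≤ PRM F d (m + 1)) :
    ∃ a g, finrank F D ≤ a + finrank F (RM F (d - 1) (m + 1)) ∧ a ≤ finrank F (PRM F d m) ∧
      a ≤ finrank F D ∧ finrank F D ≤ g + finrank F (RM F d (m + 1)) ∧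
      g ≤ finrank F (PRM F (d - (Fintype.card F - 1)) m) ∧ g ≤ a ∧
      max (ghw (RM F d (m + 1)) (finrank F D - g))
        (ghw (RM F (d - 1) (m + 1)) (finrank F D - a)) +
      max (ghw (PRM F d m) a) (ghw (PRM F (d - (Fintype.card F - 1)) m) g) ≤
        (codeSupport D).ncard := by
  have ha := finrank_map_add_finrank_inf_ker (affRes F (m + 1)) D
  have hi := finrank_map_add_finrank_inf_ker (infRes F m) D
  set Ka := D ⊓ LinearMap.ker (affRes F (m + 1)) with hKa
  set Ki := D ⊓ LinearMap.ker (infRes F m) with hKi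
  -- A word is determined by its two restrictions, so each is injective on the kernel of the other.
  have hKa' : finrank F (Ka.map (infRes F m)) = finrank F Ka := by
    have h := finrank_map_add_finrank_inf_ker (infRes F m) Ka
    have h0 : Ka ⊓ LinearMap.ker (infRes F m) = ⊥ :=
      (Submodule.eq_bot_iff _).mpr fun c hc => eq_zero_of_affRes_infRes hc.1.2 hc.2
    rwa [h0, finrank_bot, add_zero] at h
  have hKi' : finrank F (Ki.map (affRes F (m + 1))) = finrank F Ki := by
    have h := finrank_map_add_finrank_inf_ker (affRes F (m + 1)) Ki
    have h0 : Ki ⊓ LinearMap.ker (affRes F (m + 1)) = ⊥ :=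
      (Submodule.eq_bot_iff _).mpr fun c hc => eq_zero_of_affRes_infRes hc.2 hc.1.2
    rwa [h0, finrank_bot, add_zero] at h
  have haD : D.map (affRes F (m + 1)) ≤ RM F d (m + 1) :=
    Submodule.map_le_iff_le_comap.mpr fun c hc => affRes_mem_RM hd (hD hc)
  have hiD : D.map (infRes F m) ≤ PRM F d m :=
    Submodule.map_le_iff_le_comap.mpr fun c hc => infRes_mem_PRM hd (hD hc)
  have haK : Ki.map (affRes F (m + 1)) ≤ RM F (d - 1) (m + 1) :=
    Submodule.map_le_iff_le_comap.mpr fun c hc =>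
      affRes_mem_RM_of_infRes_eq_zero hd (hD hc.1) hc.2
  have hiK : Ka.map (infRes F m) ≤ PRM F (d - (Fintype.card F - 1)) m :=
    Submodule.map_le_iff_le_comap.mpr fun c hc =>
      infRes_mem_PRM_of_affRes_eq_zero hd (hD hc.1) hc.2
  have haK' : Ki.map (affRes F (m + 1)) ≤ D.map (affRes F (m + 1)) :=
    Submodule.map_mono inf_le_left
  have hiK' : Ka.map (infRes F m) ≤ D.map (infRes F m) := Submodule.map_mono inf_le_left
  have r1 := Submodule.finrank_mono haD
  have r2 := Submodule.finrank_mono hiD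
  have r3 := Submodule.finrank_mono haK
  have r4 := Submodule.finrank_mono hiK
  have r6 := Submodule.finrank_mono hiK'
  refine ⟨finrank F (D.map (infRes F m)), finrank F Ka, by omega, r2, by omega, by omega,
    by omega, by omega, ?_⟩
  rw [ncard_codeSupport_eq]
  refine Nat.add_le_add (max_le ?_ ?_) (max_le ?_ ?_)
  · exact ghw_le haD (by omega)
  · exact (ghw_le haK (by omega)).trans
      (Set.ncard_le_ncard (codeSupport_mono haK') (Set.toFinite _))
  · exact ghw_le hiD rfl
  · exact (ghw_le hiK hKa').trans
      (Set.ncard_le_ncard (codeSupport_mono hiK') (Set.toFinite _))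

end Splitting

namespace PlaneBound

variable {F : Type*} [Field F] [Fintype F] {d r : ℕ}

theorem mem_Y {a g : ℕ} : (a, g) ∈ Y F d r ↔ r ≤ a + finrank F (RM F (d - 1) 2) ∧
    a ≤ finrank F (PRM F d 1) ∧ a ≤ r ∧ r ≤ g + finrank F (RM F d 2) ∧
    g ≤ finrank F (PRM F (d - (Fintype.card F - 1)) 1) ∧ g ≤ a := by
  simp only [Y, Set.mem_ofPred_eq, le_min_iff, max_le_iff, Nat.zero_le, and_true,
    Nat.sub_le_iff_le_add, and_assoc]

theorem exists_mem_Y_B_le {D : Submodule F (ProjPts F 2 → F)} (hd : d ≠ 0) (hD : D ≤ PRM F d 2)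
    (hr : finrank F D = r) : ∃ p ∈ Y F d r, B F d r p.1 p.2 ≤ (codeSupport D).ncard := by
  obtain ⟨a, g, h1, h2, h3, h4, h5, h6, h7⟩ := exists_le_ncard_codeSupport hd hD
  subst hr
  exact ⟨(a, g), mem_Y.mpr ⟨h1, h2, h3, h4, h5, h6⟩, h7⟩

/-- Splitting any `r`-dimensional subcode produces an admissible pair. -/
theorem Y_nonempty (hd : d ≠ 0) (hr : r ≤ finrank F (PRM F d 2)) : (Y F d r).Nonempty := by
  obtain ⟨D, hD, h⟩ := (PRM F d 2).exists_le_finrank_eq hr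
  obtain ⟨p, hp, -⟩ := exists_mem_Y_B_le hd hD h
  exact ⟨p, hp⟩

theorem minB_le {a g : ℕ} (h : (a, g) ∈ Y F d r) : minB F d r ≤ B F d r a g :=
  Nat.sInf_le ⟨(a, g), h, rfl⟩

theorem minB_le_ghw (hd : d ≠ 0) (hr : r ≤ finrank F (PRM F d 2)) :
    minB F d r ≤ ghw (PRM F d 2) r := by
  obtain ⟨D, hD, h, h'⟩ := exists_ghw hr
  obtain ⟨p, hp, hle⟩ := exists_mem_Y_B_le hd hD h
  exact (minB_le hp).trans (hle.trans_eq h'.symm)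

end PlaneBound

/-! ### Upper bounds: extension by zero and cones. -/

section UpperBounds

variable {F : Type*} [Field F]

theorem ghw_PRM_le_ghw_RM [Finite F] {d r m : ℕ} (hd : d ≠ 0)
    (hr : r ≤ finrank F (RM F (d - 1) (m + 1))) :
    ghw (PRM F d (m + 1)) r ≤ ghw (RM F (d - 1) (m + 1)) r := by
  obtain ⟨D, hD, h, h'⟩ := exists_ghw hr
  let E : ((Fin (m + 1) → F) → F) →ₗ[F] (ProjPts F (m + 1) → F) :=
    Function.ExtendByZero.linearMap F ProjPts.aff
  have hE : ∀ u, affRes F (m + 1) (E u) = u := fun u => funext fun x =>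
    ProjPts.aff_injective.extend_apply _ _ _
  have hE0 : ∀ u, infRes F m (E u) = 0 := fun u => funext fun y =>
    Function.extend_apply' _ _ _ fun ⟨x, hx⟩ => ProjPts.aff_ne_inf x y hx
  have hinj : Function.Injective E := fun u v huv => by rw [← hE u, huv, hE]
  rw [h']
  refine (ghw_le (D := D.map E) ?_ ?_).trans_eq ?_
  · rintro _ ⟨u, hu, rfl⟩
    exact mem_PRM_of_affRes_mem_RM hd (by rw [hE]; exact hD hu) (hE0 u)
  · rw [← h]
    exact (Submodule.equivMapOfInjective E hinj D).finrank_eq.symm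
  · rw [ncard_codeSupport_eq, ← Submodule.map_comp, ← Submodule.map_comp,
      show affRes F (m + 1) ∘ₗ E = LinearMap.id from LinearMap.ext hE,
      show infRes F m ∘ₗ E = 0 from LinearMap.ext hE0, Submodule.map_id, Submodule.map_zero,
      codeSupport_bot, Set.ncard_empty, add_zero]

/-- The cone over a projective code with vertex the last coordinate point. -/
theorem ghw_PRM_succ_le [Fintype F] {d r m : ℕ} (hd : d ≠ 0) (hr : r ≤ finrank F (PRM F d m)) :
    ghw (PRM F d (m + 1)) r ≤ Fintype.card F * ghw (PRM F d m) r := by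
  obtain ⟨D, hD, h, h'⟩ := exists_ghw hr
  -- Away from the vertex, dropping the last coordinate leaves a normalized representative.
  have hex : ∀ z : ProjPts F (m + 1), Fin.init z.1 ≠ 0 →
      ∃ i, Fin.init z.1 i = 1 ∧ ∀ j < i, Fin.init z.1 j = 0 := by
    rintro ⟨z, i, hi, hj⟩ hz
    cases i using Fin.lastCases with
    | last => exact absurd (funext fun j => hj j.castSucc (Fin.castSucc_lt_last j)) hz
    | cast i => exact ⟨i, hi, fun j hji => hj j.castSucc (Fin.castSucc_lt_castSucc_iff.mpr hji)⟩
  classical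
  let T : (ProjPts F m → F) →ₗ[F] (ProjPts F (m + 1) → F) :=
    { toFun := fun c z => if hz : Fin.init z.1 ≠ 0 then c ⟨Fin.init z.1, hex z hz⟩ else 0
      map_add' := fun c c' => by
        funext z
        by_cases hz : Fin.init z.1 = 0
        · simp [hz]
        · simp only [ne_eq, hz, not_false_eq_true, dite_true, Pi.add_apply]
          rfl
      map_smul' := fun a c => by
        funext z
        by_cases hz : Fin.init z.1 = 0
        · simp [hz]
        · simp only [ne_eq, hz, not_false_eq_true, dite_true, Pi.smul_apply, RingHom.id_apply]
          rfl }
  -- The points other than the vertex are pairs of a base point and a last coordinate, so each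
  -- support point of the base code has `Q` points above it.
  let s : ProjPts F m × F → ProjPts F (m + 1) := fun p => ⟨Fin.snoc p.1.1 p.2, by
    obtain ⟨i, hi, hj⟩ := p.1.2
    refine ⟨i.castSucc, by simpa using hi, fun j => ?_⟩
    cases j using Fin.lastCases with
    | last => exact fun h => absurd h (Fin.castSucc_lt_last i).not_gt
    | cast j => exact fun h => by simpa using hj j (Fin.castSucc_lt_castSucc_iff.mp h)⟩
  have hs : ∀ p, Fin.init (s p).1 = p.1.1 := fun p => Fin.init_snoc _ _
  have hne : ∀ y : ProjPts F m, y.1 ≠ 0 := fun y hy => by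
    obtain ⟨i, hi, -⟩ := y.2
    rw [hy] at hi
    exact zero_ne_one hi
  have hT : ∀ c p, T c (s p) = c p.1 := fun c p => by
    refine (dif_pos (show Fin.init (s p).1 ≠ 0 by rw [hs]; exact hne p.1)).trans ?_
    exact congrArg c (Subtype.ext (hs p))
  have hinj : Function.Injective T := fun u v huv => funext fun y => by
    rw [← hT u (y, 0), huv, hT]
  rw [h', ← Nat.card_eq_fintype_card, ← Set.ncard_univ, mul_comm, ← Set.ncard_prod]
  refine (ghw_le (D := D.map T) ?_ ?_).trans
    ((Set.ncard_le_ncard (t := s '' (codeSupport D ×ˢ Set.univ)) ?_ (Set.toFinite _)).trans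
      (Set.ncard_image_le (Set.toFinite _)))
  · rintro _ ⟨c, hc, rfl⟩
    obtain ⟨f, hf, hx⟩ := (mem_PRM hd).mp (hD hc)
    refine (mem_PRM hd).mpr ⟨rename Fin.castSucc f, hf.rename_isHomogeneous, fun z => ?_⟩
    rw [eval_rename]
    change _ = eval (Fin.init z.1) f
    by_cases hz : Fin.init z.1 = 0
    · rw [hz, ← zero_smul F (0 : Fin (m + 1) → F), eval_smul_of_isHomogeneous hf, zero_pow hd,
        zero_mul]
      exact dif_neg (not_not.mpr hz)
    · exact (dif_pos hz).trans (hx _)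
  · rw [← h]
    exact (Submodule.equivMapOfInjective T hinj D).finrank_eq.symm
  · rintro z ⟨_, ⟨c, hc, rfl⟩, hz⟩
    have hz0 : Fin.init z.1 ≠ 0 := fun h0 => hz (dif_neg (not_not.mpr h0))
    refine ⟨(⟨Fin.init z.1, hex z hz0⟩, z.1 (Fin.last _)), ⟨⟨c, hc, ?_⟩, trivial⟩,
      Subtype.ext (Fin.snoc_init_self z.1)⟩
    rwa [show T c z = c ⟨Fin.init z.1, hex z hz0⟩ from dif_pos hz0] at hz

end UpperBounds

/-! ### Minimization over `Y` and the closed forms of the bound. -/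

namespace PlaneBound

variable {F : Type*} [Field F] {d r : ℕ}

theorem alphaIdx_spec [Finite F] {i : ℕ} (hi : i ≤ r) :
    i ≤ alphaIdx F d r i ∧ alphaIdx F d r i ≤ r ∧
    r - alphaIdx F d r i ≤ finrank F (RM F (d - 1) 2) ∧
    ghw (RM F (d - 1) 2) (r - alphaIdx F d r i) ≤ ghw (RM F d 2) (r - i) :=
  Nat.sInf_mem (s := {a | i ≤ a ∧ a ≤ r ∧ r - a ≤ finrank F (RM F (d - 1) 2) ∧
    ghw (RM F (d - 1) 2) (r - a) ≤ ghw (RM F d 2) (r - i)})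
    -- The candidate `r` is always admissible because the zeroth weight is `0`; hence the infimum is
    -- attained.
    ⟨r, hi, le_rfl, by omega, by rw [Nat.sub_self, ghw_zero]; exact Nat.zero_le _⟩

theorem alphaIdx_le {i a : ℕ} (h₁ : i ≤ a) (h₂ : a ≤ r)
    (h₃ : r - a ≤ finrank F (RM F (d - 1) 2))
    (h₄ : ghw (RM F (d - 1) 2) (r - a) ≤ ghw (RM F d 2) (r - i)) : alphaIdx F d r i ≤ a :=
  Nat.sInf_le ⟨h₁, h₂, h₃, h₄⟩

variable [Fintype F]

theorem exists_mem_Y_B_eq_minB (h : (Y F d r).Nonempty) :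
    ∃ a g, (a, g) ∈ Y F d r ∧ B F d r a g = minB F d r := by
  obtain ⟨⟨a, g⟩, hp, h⟩ := Nat.sInf_mem (h.image fun p : ℕ × ℕ => B F d r p.1 p.2)
  exact ⟨a, g, hp, h⟩

/-- The existence clause in `alphaIdx` already forces `r - dim ≤ α_i`. -/
theorem muIdx_eq {i : ℕ} (hi : i ≤ r) : muIdx F d r i = alphaIdx F d r i := by
  have h := (alphaIdx_spec (F := F) (d := d) hi).2.2.1
  exact max_eq_left (by omega)

/-- If the codimension of the smaller affine code is at most `K`, the weight of index `r - i - K`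
there is at most the weight of index `r - i` of the larger one. This rules out the branches with
`α_γ > λ`. -/
theorem alphaIdx_le_min {i : ℕ} (hi : i ≤ r) (hr : r ≤ i + finrank F (RM F d 2)) :
    alphaIdx F d r i ≤
      min (i + (min d (Fintype.card F - 1) + 1 - (d + 1 - Fintype.card F))) r := by
  have hK := finrank_RM_two_le (F := F) d
  set K := min d (Fintype.card F - 1) + 1 - (d + 1 - Fintype.card F)
  refine alphaIdx_le (by omega) (min_le_right _ _) (by omega) ?_
  rw [show r - min (i + K) r = r - i - K by omega]
  exact ghw_sub_le_of_finrank_le (RM_mono (Nat.sub_le d 1) 2) hK (by omega)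

/-- For fixed `γ` the bound is smallest at `α = α_γ`. -/
theorem ghw_add_max_alphaIdx_le {a g : ℕ} (h : (a, g) ∈ Y F d r) (c : ℕ) :
    ghw (RM F d 2) (r - g) + max (alphaIdx F d r g) c ≤
      max (ghw (RM F d 2) (r - g)) (ghw (RM F (d - 1) 2) (r - a)) + max a c := by
  obtain ⟨h1, -, h3, h4, -, h6⟩ := mem_Y.mp h
  obtain ⟨s1, s2, s3, s4⟩ := alphaIdx_spec (F := F) (d := d) (h6.trans h3)
  by_cases ha : alphaIdx F d r g ≤ a
  · omega
  -- By minimality `α_γ - 1` violates the defining inequality, which gains one; each further step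
  -- down to `a` gains at least one more. The total `α_γ - a` pays for the smaller second term.
  · have hlt : ghw (RM F d 2) (r - g) <
        ghw (RM F (d - 1) 2) (r - (alphaIdx F d r g - 1)) := by
      by_contra hle
      have := alphaIdx_le (F := F) (d := d) (r := r) (i := g) (a := alphaIdx F d r g - 1)
        (by omega) (by omega) (by omega) (not_lt.mp hle)
      omega
    have hmono := ghw_mono (C := RM F (d - 1) 2) (r := r - (alphaIdx F d r g - 1)) (r' := r - a)
      (by omega) (by omega)
    omega

theorem eq_zero_of_le_finrank_PRM {g : ℕ}
    (hg : g ≤ finrank F (PRM F (d - (Fintype.card F - 1)) 1)) (hd : d < Fintype.card F) :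
    g = 0 := by
  rw [Nat.sub_eq_zero_of_le (by omega), PRM_zero, finrank_bot] at hg
  omega

theorem B_zero_zero (hr : r ≤ finrank F (RM F (d - 1) 2)) :
    B F d r 0 0 = ghw (RM F (d - 1) 2) r := by
  rw [B, ghw_zero, ghw_zero, max_self, add_zero, Nat.sub_zero]
  exact max_eq_right (ghw_anti (RM_mono (Nat.sub_le d 1) 2) hr)

/-- At `a = 0` the weight on the line is `0` rather than `Q - d`; this jump is why `B_{0,0}` stands
apart when `d < Q`. -/
theorem B_eq_of_lt_card (hd : d ≠ 0) (hQ : d < Fintype.card F) {a g : ℕ}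
    (h : (a, g) ∈ Y F d r) (ha : a ≠ 0) :
    B F d r a g = max (ghw (RM F d 2) r) (ghw (RM F (d - 1) 2) (r - a)) +
      (Fintype.card F - d + a) := by
  obtain ⟨-, h2, -, -, h5, -⟩ := mem_Y.mp h
  obtain rfl := eq_zero_of_le_finrank_PRM h5 hQ
  rw [B, ghw_zero, ghw_PRM_one hd (by omega) h2, Nat.sub_zero, max_eq_left (Nat.zero_le _)]

theorem alphaIdx_mem_Y_of_lt_card (hd : d ≠ 0) (hQ : d < Fintype.card F)
    (hr : r ≤ finrank F (RM F d 2)) : (alphaIdx F d r 0, 0) ∈ Y F d r := by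
  obtain ⟨-, s2, s3, -⟩ := alphaIdx_spec (F := F) (d := d) (Nat.zero_le r)
  have h := alphaIdx_le_min (F := F) (d := d) (Nat.zero_le r) (by omega)
  exact mem_Y.mpr ⟨by omega, by rw [finrank_PRM_one hd]; omega, s2, by omega, Nat.zero_le _,
    Nat.zero_le _⟩

theorem HLow_eq (hQ : d < Fintype.card F) (hr : r ≤ finrank F (RM F d 2)) :
    HLow F d r = ghw (RM F d 2) r + (Fintype.card F - d) + alphaIdx F d r 0 := by
  have h := alphaIdx_le_min (F := F) (d := d) (Nat.zero_le r) (by omega)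
  rw [HLow, if_pos (by omega), muIdx_eq (Nat.zero_le r)]

theorem le_finrank_RM_of_Y_nonempty (hQ : d < Fintype.card F) (hY : (Y F d r).Nonempty) :
    r ≤ finrank F (RM F d 2) := by
  obtain ⟨⟨a, g⟩, h⟩ := hY
  obtain ⟨-, -, -, h4, h5, -⟩ := mem_Y.mp h
  have := eq_zero_of_le_finrank_PRM h5 hQ
  omega

theorem HLow_le_B (hd : d ≠ 0) (hQ : d < Fintype.card F) {a g : ℕ} (h : (a, g) ∈ Y F d r)
    (ha : a ≠ 0) : HLow F d r ≤ B F d r a g := by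
  rw [HLow_eq hQ (le_finrank_RM_of_Y_nonempty hQ ⟨_, h⟩), B_eq_of_lt_card hd hQ h ha]
  obtain rfl := eq_zero_of_le_finrank_PRM (mem_Y.mp h).2.2.2.2.1 hQ
  have := ghw_add_max_alphaIdx_le h 0
  rw [Nat.sub_zero] at this
  omega

theorem B_alphaIdx_eq_HLow (hd : d ≠ 0) (hQ : d < Fintype.card F)
    (hr : r ≤ finrank F (RM F d 2)) (ha : alphaIdx F d r 0 ≠ 0) :
    B F d r (alphaIdx F d r 0) 0 = HLow F d r := by
  have h := (alphaIdx_spec (F := F) (d := d) (Nat.zero_le r)).2.2.2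
  rw [Nat.sub_zero] at h
  rw [B_eq_of_lt_card hd hQ (alphaIdx_mem_Y_of_lt_card hd hQ hr) ha, HLow_eq hQ hr,
    max_eq_left h]
  omega

theorem minB_eq_min_HLow (hd : d ≠ 0) (hQ : d < Fintype.card F) (hY : (Y F d r).Nonempty)
    (hr : r ≤ finrank F (RM F (d - 1) 2)) :
    minB F d r = min (B F d r 0 0) (HLow F d r) := by
  have hr' := le_finrank_RM_of_Y_nonempty hQ hY
  have h00 : (0, 0) ∈ Y F d r :=
    mem_Y.mpr ⟨by omega, Nat.zero_le _, Nat.zero_le _, by omega, Nat.zero_le _, le_rfl⟩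
  refine le_antisymm (le_min (minB_le h00) ?_) ?_
  -- When `α_0 = 0`, `HLow` need not be a value of `B`, but it is at least `B_{0,0}`.
  · by_cases ha : alphaIdx F d r 0 = 0
    · have h := (alphaIdx_spec (F := F) (d := d) (Nat.zero_le r)).2.2.2
      rw [ha, Nat.sub_zero] at h
      have h2 := minB_le h00
      rw [B_zero_zero hr] at h2
      rw [HLow_eq hQ hr']
      omega
    · rw [← B_alphaIdx_eq_HLow hd hQ hr' ha]
      exact minB_le (alphaIdx_mem_Y_of_lt_card hd hQ hr')
  · obtain ⟨a, g, h, heq⟩ := exists_mem_Y_B_eq_minB hY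
    rw [← heq]
    by_cases ha : a = 0
    · obtain rfl := eq_zero_of_le_finrank_PRM (mem_Y.mp h).2.2.2.2.1 hQ
      rw [ha]
      exact min_le_left _ _
    · exact (min_le_right _ _).trans (HLow_le_B hd hQ h ha)

theorem minB_eq_B_alphaIdx (hd : d ≠ 0) (hQ : d < Fintype.card F) (hY : (Y F d r).Nonempty)
    (hr : finrank F (RM F (d - 1) 2) < r) :
    minB F d r = B F d r (alphaIdx F d r 0) 0 := by
  have hr' := le_finrank_RM_of_Y_nonempty hQ hY
  have hpos : ∀ {a g}, (a, g) ∈ Y F d r → a ≠ 0 := fun {a g} h => by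
    have := (mem_Y.mp h).1
    omega
  have hmem := alphaIdx_mem_Y_of_lt_card hd hQ hr'
  refine le_antisymm (minB_le hmem) ?_
  obtain ⟨a, g, h, heq⟩ := exists_mem_Y_B_eq_minB hY
  rw [← heq, B_alphaIdx_eq_HLow hd hQ hr' (hpos hmem)]
  exact HLow_le_B hd hQ h (hpos h)

theorem mem_E {g : ℕ} : g ∈ E F d r ↔
    r ≤ g + finrank F (RM F d 2) ∧ g ≤ d - Fintype.card F + 2 ∧ g ≤ r := by
  simp only [E, Set.mem_ofPred_eq, le_min_iff, max_le_iff, Nat.zero_le, and_true,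
    Nat.sub_le_iff_le_add]

theorem finrank_PRM_one_sub (hQ : Fintype.card F ≤ d) (hd : d ≤ 2 * (Fintype.card F - 1)) :
    finrank F (PRM F (d - (Fintype.card F - 1)) 1) = d - Fintype.card F + 2 := by
  have hcard := Fintype.one_lt_card (α := F)
  rw [finrank_PRM_one (by omega)]
  omega

/-- For `d ≥ Q` the weights of `PRM F d 1` are simply `a`, with no jump at `0`; the jump moves to `g
= 0` in the code of degree `d - (Q - 1)`. -/
theorem B_eq_of_card_le (hQ : Fintype.card F ≤ d) (hd : d ≤ 2 * (Fintype.card F - 1)) {a g : ℕ}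
    (h : (a, g) ∈ Y F d r) :
    B F d r a g = max (ghw (RM F d 2) (r - g)) (ghw (RM F (d - 1) 2) (r - a)) +
      max a (if g = 0 then 0 else 2 * Fintype.card F - d + g - 1) := by
  have hcard := Fintype.one_lt_card (α := F)
  obtain ⟨-, h2, -, -, h5, -⟩ := mem_Y.mp h
  have ha : ghw (PRM F d 1) a = a := by
    by_cases ha : a = 0
    · rw [ha, ghw_zero]
    · rw [ghw_PRM_one (by omega) (by omega) h2]
      omega
  have hg : ghw (PRM F (d - (Fintype.card F - 1)) 1) g =
      if g = 0 then 0 else 2 * Fintype.card F - d + g - 1 := by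
    split_ifs with hg
    · rw [hg, ghw_zero]
    · rw [ghw_PRM_one (by omega) (by omega) h5]
      omega
  rw [B, ha, hg]

/-- The codimension bound is `2Q - 1 - d`; added to `g ≤ d - Q + 2` it gives exactly `Q + 1`. -/
theorem alphaIdx_le_of_card_le (hQ : Fintype.card F ≤ d) (hd : d ≤ 2 * (Fintype.card F - 1))
    {g : ℕ} (hg : g ∈ E F d r) : alphaIdx F d r g ≤ min (Fintype.card F + 1) r := by
  have hcard := Fintype.one_lt_card (α := F)
  obtain ⟨h1, h2, h3⟩ := mem_E.mp hg
  have h := alphaIdx_le_min (F := F) (d := d) h3 h1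
  omega

theorem HHigh_eq (hQ : Fintype.card F ≤ d) (hd : d ≤ 2 * (Fintype.card F - 1)) {g : ℕ}
    (hg : g ∈ E F d r) : HHigh F d r g = ghw (RM F d 2) (r - g) +
      max (alphaIdx F d r g) (if g = 0 then 0 else 2 * Fintype.card F - d + g - 1) := by
  have hle := alphaIdx_le_of_card_le hQ hd hg
  have hmu := muIdx_eq (F := F) (d := d) (mem_E.mp hg).2.2
  by_cases h : g = 0
  · subst h
    simp only [HHigh, if_pos, if_pos hle, hmu, Nat.sub_zero, Nat.max_zero]
  · simp only [HHigh, if_neg h, if_pos hle, hmu]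

theorem alphaIdx_mem_Y_of_card_le (hQ : Fintype.card F ≤ d)
    (hd : d ≤ 2 * (Fintype.card F - 1)) {g : ℕ} (hg : g ∈ E F d r) :
    (alphaIdx F d r g, g) ∈ Y F d r := by
  have hcard := Fintype.one_lt_card (α := F)
  have hle := alphaIdx_le_of_card_le hQ hd hg
  obtain ⟨h1, h2, h3⟩ := mem_E.mp hg
  obtain ⟨s1, s2, s3, -⟩ := alphaIdx_spec (F := F) (d := d) h3
  refine mem_Y.mpr ⟨by omega, ?_, s2, h1, ?_, s1⟩
  · rw [finrank_PRM_one (by omega)]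
    omega
  · rwa [finrank_PRM_one_sub hQ hd]

theorem mem_E_of_mem_Y (hQ : Fintype.card F ≤ d) (hd : d ≤ 2 * (Fintype.card F - 1)) {a g : ℕ}
    (h : (a, g) ∈ Y F d r) : g ∈ E F d r := by
  obtain ⟨-, -, h3, h4, h5, h6⟩ := mem_Y.mp h
  rw [finrank_PRM_one_sub hQ hd] at h5
  exact mem_E.mpr ⟨h4, h5, h6.trans h3⟩

/-- `E` is the set of second coordinates of `Y`, and over each `γ` the best `α` is `α_γ`, where `B`
equals `HHigh`. No case distinction on `r` is needed. -/
theorem minB_eq_sInf_HHigh (hQ : Fintype.card F ≤ d) (hd : d ≤ 2 * (Fintype.card F - 1))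
    (hY : (Y F d r).Nonempty) : minB F d r = sInf (HHigh F d r '' E F d r) := by
  obtain ⟨a, g, h, heq⟩ := exists_mem_Y_B_eq_minB hY
  have hE := mem_E_of_mem_Y hQ hd h
  apply le_antisymm
  · obtain ⟨g', hg', hg''⟩ := Nat.sInf_mem (Set.Nonempty.image (HHigh F d r) ⟨g, hE⟩)
    have hmem := alphaIdx_mem_Y_of_card_le hQ hd hg'
    rw [← hg'', HHigh_eq hQ hd hg']
    refine (minB_le hmem).trans_eq ?_
    rw [B_eq_of_card_le hQ hd hmem,
      max_eq_left (alphaIdx_spec (F := F) (d := d) (mem_E.mp hg').2.2).2.2.2]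
  · rw [← heq, B_eq_of_card_le hQ hd h]
    refine le_trans (Nat.sInf_le ⟨g, hE, rfl⟩) ?_
    rw [HHigh_eq hQ hd hE]
    exact ghw_add_max_alphaIdx_le h _

end PlaneBound

open PlaneBound in
theorem theorem4p7 (q s : ℕ) (F : Type*) [Field F] [Fintype F] (hF : Fintype.card F = q ^ s)
    (d r : ℕ) (hd₁ : 1 ≤ d) (hd₂ : d ≤ 2 * (q ^ s - 1))
    (hr₁ : 2 ≤ r) (hr₂ : r ≤ Module.finrank F (PRM F d 2)) :
    -- the minimum over `Y` exists and is a lower bound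
    (Y F d r).Nonempty ∧ minB F d r ≤ ghw (PRM F d 2) r ∧
    -- the value of `B_{0,0}`
    (r ≤ Module.finrank F (RM F (d - 1) 2) → B F d r 0 0 = ghw (RM F (d - 1) 2) r) ∧
    -- case (a)
    (d < q ^ s →
      (r ≤ Module.finrank F (RM F (d - 1) 2) → minB F d r = min (B F d r 0 0) (HLow F d r)) ∧
      (Module.finrank F (RM F (d - 1) 2) < r → minB F d r = B F d r (alphaIdx F d r 0) 0)) ∧
    -- case (b)
    (q ^ s ≤ d →
      (E F d r).Nonempty ∧
      (r ≤ Module.finrank F (RM F (d - 1) 2) →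
        minB F d r = min (B F d r 0 0) (sInf (HHigh F d r '' E F d r))) ∧
      (Module.finrank F (RM F (d - 1) 2) < r → minB F d r = sInf (HHigh F d r '' E F d r))) ∧
    -- sharpness
    (r ≤ Module.finrank F (RM F (d - 1) 2) → minB F d r = ghw (RM F (d - 1) 2) r →
      ghw (PRM F d 2) r = minB F d r) ∧
    (r ≤ min (d + 1) (q ^ s + 1) → minB F d r = q ^ s * max (q ^ s + r - d) r →
      ghw (PRM F d 2) r = minB F d r) := by
  rw [← hF] at hd₂ ⊢
  have hd : d ≠ 0 := by omega
  have hcard := Fintype.one_lt_card (α := F)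
  have hY := Y_nonempty hd hr₂
  have hlow := minB_le_ghw hd hr₂
  refine ⟨hY, hlow, B_zero_zero,
    fun hQ => ⟨minB_eq_min_HLow hd hQ hY, minB_eq_B_alphaIdx hd hQ hY⟩,
    fun hQ => ⟨?_, fun hr => ?_, fun _ => minB_eq_sInf_HHigh hQ hd₂ hY⟩,
    fun hr h => le_antisymm ((ghw_PRM_le_ghw_RM hd hr).trans_eq h.symm) hlow,
    fun hr h => le_antisymm ?_ hlow⟩
  · obtain ⟨⟨a, g⟩, h⟩ := hY
    exact ⟨g, mem_E_of_mem_Y hQ hd₂ h⟩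
  -- Here `(0, 0)` lies in `Y`, so taking the minimum with `B_{0,0}` changes nothing.
  · rw [← minB_eq_sInf_HHigh hQ hd₂ hY]
    refine (min_eq_right (minB_le (mem_Y.mpr ⟨by omega, Nat.zero_le _, Nat.zero_le _, ?_,
      Nat.zero_le _, le_rfl⟩))).symm
    have := Submodule.finrank_mono (RM_mono (F := F) (Nat.sub_le d 1) 2)
    omega
  · have hr' : r ≤ Module.finrank F (PRM F d 1) := by
      rw [finrank_PRM_one hd]
      omega
    -- The cone gives `Q * (Q - d + r)` with truncated subtraction, which is the stated maximum.
    refine (ghw_PRM_succ_le hd hr').trans_eq ?_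
    rw [h, ghw_PRM_one hd (by omega) hr']
    congr 1
    omega
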